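/- **Setting.** An $n$-qubit Hamiltonian is a Hermitian matrix $H\in\mathbb C^{2^n\times 2^n}$; it is $s$-sparse if every row has at most $s$ nonzero entries, and $\|H\|_{\max}$ is the largest absolute value of its entries. $H$ is accessed through the black boxes $O_H|j,k,z\rangle=|j,k,z\oplus H_{jk}\rangle$, where entries are represented by $b$-bit strings through some encoding that is injective on the entries that occur, and $O_F|j,\ell\rangle=|j,f(j,\ell)\rangle$, where $f(j,\ell)$ is the column of the $\ell$-th nonzero entry of row $j$ (in increasing order; $f(j,\cdot)$ is extended to a permutation of the $2^n$ columns by listing the remaining columns in increasing order). A quantum query algorithm alternates arbitrary unitaries that do not depend on $H$ with queries, acting on the $n$-qubit system register together with ancilla registers that start in $|0\rangle$ and are discarded at the end; each query is a call of $O_H$, $O_F$ or $O_F^{\dagger}$, possibly controlled on the work space. It simulates $H$ for time $t$ with precision $\epsilon$ if the resulting channel has diamond norm distance at most $\epsilon$ from $\rho\mapsto e^{-iHt}\rho\, e^{iHt}$, where $\|\Phi-\Psi\|_\diamond=\sup_{k,\rho}\|((\Phi-\Psi)\otimes\mathrm{id}_k)(\rho)\|_1$ over all density matrices $\rho$ on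 the system and a $k$-dimensional reference (so the distance is at most $2$). **Lemma.** For every $\tau_0>0$ there are constants $0<c_1\le c_2$ and $c>0$ such that for every positive integer $d$ and every $t>0$ with $td\ge\tau_0$ there are a number $n$ and a finite nonempty family $\mathcal H$ of $2d$-sparse $n$-qubit Hamiltonians with $c_1\le\|H\|_{\max}\le c_2$ for all $H\in\mathcal H$ and with the following property: for every such encoding of the entries and every constant precision $\epsilon\in(0,1)$, any quantum query algorithm that, given the black boxes for $H$, simulates $H$ for time $t$ with precision $\epsilon$ for every $H\in\mathcal H$ makes at least $c\,td$ queries. In short: simulating $2d$-sparse Hamiltonians with $\|H\|_{\max}=\Theta(1)$ for time $t$ to constant precision requires $\Omega(td)$ queries. -/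

import Mathlib

open scoped Matrix Kronecker ENNReal ComplexOrder

noncomputable section

namespace HamSim

/-! ### Hamiltonians -/

/-- The set of columns of the nonzero entries in row `j` of `H`. -/
def rowSupport {m : Type*} [Fintype m] (H : Matrix m m ℂ) (j : m) : Finset m :=
  open Classical in Finset.univ.filter fun k => H j k ≠ 0

/-- `H` is `s`-sparse: every row has at most `s` nonzero entries. -/
def IsSparse {m : Type*} [Fintype m] (s : ℕ) (H : Matrix m m ℂ) : Prop :=
  ∀ j, (rowSupport H j).card ≤ s

/-- The largest absolute value of an entry of `H`. -/
def maxNorm {m : Type*} [Fintype m] (H : Matrix m m ℂ) : ℝ :=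
  ((Finset.univ.sup fun p : m × m => ‖H p.1 p.2‖₊ : NNReal) : ℝ)

/-- The evolution operator `exp (-i H t)`. -/
def evolution {m : Type*} [Fintype m] [DecidableEq m] (H : Matrix m m ℂ) (t : ℝ) :
    Matrix m m ℂ :=
  NormedSpace.exp ((-(Complex.I * (t : ℂ))) • H)

/-! ### Channels and the diamond norm distance -/

/-- The trace norm (sum of the singular values) of a square matrix. -/
def traceNorm {m : Type*} [Fintype m] [DecidableEq m] (A : Matrix m m ℂ) : ℝ :=
  ∑ i, Real.sqrt ((Matrix.isHermitian_conjTranspose_mul_self A).eigenvalues i)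

/-- Density matrices: positive semidefinite matrices of trace one. -/
def IsDensity {m : Type*} [Fintype m] (ρ : Matrix m m ℂ) : Prop :=
  ρ.PosSemidef ∧ ρ.trace = 1

/-- The map `Φ ⊗ id` on matrices over the tensor product of the space of `Φ` with a
`k`-dimensional reference space: `Φ` is applied to each of the `k × k` blocks. -/
def ampliation {m : Type*} (Φ : Matrix m m ℂ → Matrix m m ℂ) (k : ℕ)
    (X : Matrix (m × Fin k) (m × Fin k) ℂ) : Matrix (m × Fin k) (m × Fin k) ℂ :=
  Matrix.of fun p q => Φ (Matrix.of fun i j => X (i, p.2) (j, q.2)) p.1 q.1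

/-- The diamond norm distance of two channels: the supremum, over all finite reference spaces and
all density matrices `ρ` on the joint space, of the trace norm of `(Φ ⊗ id) ρ - (Ψ ⊗ id) ρ`
(without a factor `1/2`, so that two channels are at distance at most `2`). -/
def diamondDist {m : Type*} [Fintype m] [DecidableEq m]
    (Φ Ψ : Matrix m m ℂ → Matrix m m ℂ) : ℝ≥0∞ :=
  ⨆ (k : ℕ) (ρ : Matrix (m × Fin k) (m × Fin k) ℂ) (_ : IsDensity ρ),
    ENNReal.ofReal (traceNorm (ampliation Φ k ρ - ampliation Ψ k ρ))

/-- The channel `ρ ↦ U ρ U†`. -/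
def conjChannel {m : Type*} [Fintype m] (U : Matrix m m ℂ) (ρ : Matrix m m ℂ) :
    Matrix m m ℂ :=
  U * ρ * Uᴴ

/-- The partial trace over the second factor. -/
def partialTrace {m r : Type*} [Fintype r] (M : Matrix (m × r) (m × r) ℂ) : Matrix m m ℂ :=
  Matrix.of fun i j => ∑ a, M (i, a) (j, a)

/-! ### The black box for a sparse Hamiltonian -/

/-- Bit strings of length `b`. -/
abbrev Bits (b : ℕ) : Type := Fin b → Bool

/-- Bitwise addition modulo two, `y ↦ y ⊕ z`. -/
def xorPerm {b : ℕ} (z : Bits b) : Equiv.Perm (Bits b) where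
  toFun y := fun i => xor (y i) (z i)
  invFun y := fun i => xor (y i) (z i)
  left_inv y := by funext i; simp
  right_inv y := by funext i; simp

/-- The in-place location function `ℓ ↦ f (j, ℓ)` of row `j`: it lists the columns of the nonzero
entries of row `j` in increasing order; the remaining positions (which an in-place unitary has to
send somewhere) list the remaining columns in increasing order. -/
def locPerm {D : ℕ} (H : Matrix (Fin D) (Fin D) ℂ) (j : Fin D) : Equiv.Perm (Fin D) :=
  (finCongr (by rw [Finset.card_add_card_compl, Fintype.card_fin] :
      D = (rowSupport H j).card + (rowSupport H j)ᶜ.card)).trans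
    (finSumFinEquiv.symm.trans (finSumEquivOfFinset rfl rfl))

/-- The possible calls to the black box: none, the entry oracle `O_H` (which is its own inverse),
the location oracle `O_F`, and the inverse of `O_F`. -/
inductive Call where
  | idle
  | entry
  | loc
  | locInv

/-- The basis states `|j, k, z⟩` of the query registers. -/
abbrev QueryReg (n b : ℕ) : Type := Fin (2 ^ n) × Fin (2 ^ n) × Bits b

/-- The action of a call on the basis states of the query registers, where `enc` gives the bit
string that represents a matrix entry:
`O_H |j, k, z⟩ = |j, k, z ⊕ H j k⟩` and `O_F |j, ℓ, z⟩ = |j, f (j, ℓ), z⟩`. -/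
def callMap {n b : ℕ} (enc : ℂ → Bits b) (H : Matrix (Fin (2 ^ n)) (Fin (2 ^ n)) ℂ) :
    Call → QueryReg n b → QueryReg n b
  | .idle, x => x
  | .entry, (j, k, z) => (j, k, xorPerm (enc (H j k)) z)
  | .loc, (j, l, z) => (j, locPerm H j l, z)
  | .locInv, (j, k, z) => (j, (locPerm H j).symm k, z)

/-! ### Query algorithms -/

/-- The basis states of the ancilla: the second and the third query register, and a work space of
`w` qubits. -/
abbrev Ancilla (n b w : ℕ) : Type := Fin (2 ^ n) × Bits b × Fin (2 ^ w)

/-- The basis states of the whole computer. The first factor is the `n`-qubit register that holds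
the input state and, at the end, the output state; it serves also as the first query register. -/
abbrev Register (n b w : ℕ) : Type := Fin (2 ^ n) × Ancilla n b w

/-- The operator of a single (controlled) query: on basis states whose work space is in the state
`a`, the call `sel a` is applied to the query registers. -/
def queryOp {n b w : ℕ} (enc : ℂ → Bits b) (H : Matrix (Fin (2 ^ n)) (Fin (2 ^ n)) ℂ)
    (sel : Fin (2 ^ w) → Call) : Matrix (Register n b w) (Register n b w) ℂ :=
  Matrix.of fun y x =>
    if (y.1, y.2.1, y.2.2.1) = callMap enc H (sel x.2.2.2) (x.1, x.2.1, x.2.2.1) ∧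
      y.2.2.2 = x.2.2.2 then 1 else 0

/-- A quantum query algorithm: a number of work qubits, a number of queries, the unitary operations
(independent of the Hamiltonian) that are performed before, between and after the queries, and the
control pattern of each query. -/
structure QueryAlgorithm (n b : ℕ) where
  work : ℕ
  queries : ℕ
  unitary : Fin (queries + 1) → Matrix.unitaryGroup (Register n b work) ℂ
  sel : Fin queries → Fin (2 ^ work) → Call

namespace QueryAlgorithm

variable {n b : ℕ}

/-- The operator `U_i O_i U_(i-1) O_(i-1) ⋯ O_1 U_0` of the first `i` queries. -/
def opAux (A : QueryAlgorithm n b) (enc : ℂ → Bits b)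
    (H : Matrix (Fin (2 ^ n)) (Fin (2 ^ n)) ℂ) :
    (i : ℕ) → i ≤ A.queries → Matrix (Register n b A.work) (Register n b A.work) ℂ
  | 0, _ => (A.unitary 0 : Matrix (Register n b A.work) (Register n b A.work) ℂ)
  | i + 1, h =>
    (A.unitary ⟨i + 1, Nat.lt_succ_of_le h⟩ :
        Matrix (Register n b A.work) (Register n b A.work) ℂ) *
      queryOp enc H (A.sel ⟨i, h⟩) * A.opAux enc H i (Nat.le_of_succ_le h)

/-- The operator performed by the whole algorithm. -/
def op (A : QueryAlgorithm n b) (enc : ℂ → Bits b) (H : Matrix (Fin (2 ^ n)) (Fin (2 ^ n)) ℂ) :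
    Matrix (Register n b A.work) (Register n b A.work) ℂ :=
  A.opAux enc H A.queries le_rfl

/-- The initial basis state of the ancilla: all qubits are zero. -/
def ancillaZero (n b w : ℕ) : Ancilla n b w := (0, fun _ => false, 0)

/-- The channel on `n` qubits implemented by the algorithm: adjoin the ancilla in its initial
state, run the algorithm, and discard the ancilla. -/
def channel (A : QueryAlgorithm n b) (enc : ℂ → Bits b)
    (H : Matrix (Fin (2 ^ n)) (Fin (2 ^ n)) ℂ) (ρ : Matrix (Fin (2 ^ n)) (Fin (2 ^ n)) ℂ) :
    Matrix (Fin (2 ^ n)) (Fin (2 ^ n)) ℂ :=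
  partialTrace (conjChannel (A.op enc H)
    (ρ ⊗ₖ Matrix.single (ancillaZero n b A.work) (ancillaZero n b A.work) 1))

/-- With the black box for `H`, the algorithm implements `exp (-i H t)` up to an error of at most
`ε` in diamond norm distance. -/
def Simulates (A : QueryAlgorithm n b) (enc : ℂ → Bits b)
    (H : Matrix (Fin (2 ^ n)) (Fin (2 ^ n)) ℂ) (t ε : ℝ) : Prop :=
  diamondDist (A.channel enc H) (conjChannel (evolution H t)) ≤ ENNReal.ofReal ε

end QueryAlgorithm

end HamSim

end

noncomputable section

namespace HamSim

/-! ### The trace norm bounds diagonal observables -/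

/-! The parity of `N` bits is hidden in a Hamiltonian. Vertices are `(k, b, i)`: layer `k`, running
parity `b`, copy `i < d`. Bit `x k` decides which parity class of layer `k + 1` is joined,
completely bipartitely, to a given class of layer `k`. On states uniform in `i` this is a walk on a
path whose edge weights are multiplied by `d` (`parityHam_mulVec`). With weights `g * √((k + 1) * (N
- k))`, those of a rotating spin `N / 2`, the walk moves exactly from layer `0` to layer `N` when `t
* d * g = π / 2` (`evolution_parityHam_mulVec`), and `b` then holds the parity of `x`. Since the
largest weight is of order `g * N`, taking `N = ⌈t * d⌉` keeps the entries of order one.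

The query bound is the polynomial method. A call reads one row of the matrix, hence at most two bits
of `x`; after `q` queries the amplitudes are combinations of functions of `2 * q` bits, and
expectations of observables of functions of `4 * q` bits. If `4 * q < N`, these are orthogonal to
the parity sign, whereas a simulation with precision `ε < 1` makes one of them `ε`-close to that
sign (`card_le_of_simulates_of_parity`). -/

theorem norm_sum_mul_diag_le_traceNorm {m : Type*} [Fintype m] [DecidableEq m]
    (Δ : Matrix m m ℂ) (z : m → ℂ) (hz : ∀ i, ‖z i‖ ≤ 1) :
    ‖∑ i, z i * Δ i i‖ ≤ traceNorm Δ := by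
  set hA := Matrix.isHermitian_conjTranspose_mul_self Δ
  have htr : ∑ i, z i * Δ i i =
      LinearMap.trace ℂ _ (Matrix.toEuclideanLin (Matrix.diagonal z * Δ)) := by
    rw [Matrix.toEuclideanLin_eq_toLin_orthonormal, Matrix.trace_toLin_eq]
    simp [Matrix.trace]
  -- In an eigenbasis of `Δᴴ * Δ`, each vector is sent by `Δ` to one whose norm is a singular value,
  -- and `diagonal z` is a contraction.
  rw [htr, LinearMap.trace_eq_sum_inner _ hA.eigenvectorBasis]
  refine (norm_sum_le _ _).trans (Finset.sum_le_sum fun i _ => ?_)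
  refine (norm_inner_le_norm _ _).trans ?_
  rw [hA.eigenvectorBasis.orthonormal.1 i, one_mul, EuclideanSpace.norm_eq]
  refine Real.sqrt_le_sqrt ?_
  rw [hA.eigenvalues_eq]
  set v : m → ℂ := (hA.eigenvectorBasis i).ofLp
  have h : star v ⬝ᵥ (Δᴴ * Δ) *ᵥ v = ((∑ j, ‖(Δ *ᵥ v) j‖ ^ 2 : ℝ) : ℂ) := by
    rw [← Matrix.mulVec_mulVec, Matrix.dotProduct_mulVec, ← Matrix.star_mulVec]
    simp [dotProduct, Complex.conj_mul']
  rw [h]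
  simp only [RCLike.re_to_complex, Complex.ofReal_re]
  refine Finset.sum_le_sum fun j _ => ?_
  have : (Matrix.toEuclideanLin (Matrix.diagonal z * Δ) (hA.eigenvectorBasis i)).ofLp j =
      z j * (Δ *ᵥ v) j := by
    rw [Matrix.toLpLin_apply, ← Matrix.mulVec_mulVec]
    exact Matrix.mulVec_diagonal _ _ _
  rw [this, norm_mul]
  gcongr
  exact mul_le_of_le_one_left (norm_nonneg _) (hz j)

theorem norm_sum_mul_diag_le_of_diamondDist_le {m : Type*} [Fintype m] [DecidableEq m]
    {Φ Ψ : Matrix m m ℂ → Matrix m m ℂ} {ε : ℝ} (hε : 0 ≤ ε)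
    (h : diamondDist Φ Ψ ≤ ENNReal.ofReal ε) {v : m → ℂ} (hv : v ⬝ᵥ star v = 1)
    (z : m → ℂ) (hz : ∀ i, ‖z i‖ ≤ 1) :
    ‖∑ i, z i * Φ (Matrix.vecMulVec v (star v)) i i -
      ∑ i, z i * Ψ (Matrix.vecMulVec v (star v)) i i‖ ≤ ε := by
  -- A trivial one-dimensional reference already suffices.
  set u : m × Fin 1 → ℂ := fun p => v p.1
  have hρ : IsDensity (Matrix.vecMulVec u (star u)) := by
    refine ⟨Matrix.posSemidef_vecMulVec_self_star u, ?_⟩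
    rw [Matrix.trace_vecMulVec, ← hv]
    simp [u, dotProduct, Fintype.sum_prod_type]
  have h1 : ENNReal.ofReal (traceNorm (ampliation Φ 1 (Matrix.vecMulVec u (star u)) -
      ampliation Ψ 1 (Matrix.vecMulVec u (star u)))) ≤ ENNReal.ofReal ε := by
    refine le_trans ?_ h
    unfold diamondDist
    exact le_iSup_of_le 1 (le_iSup_of_le _ (le_iSup_of_le hρ le_rfl))
  rw [ENNReal.ofReal_le_ofReal_iff hε] at h1
  refine le_trans (le_of_eq ?_) ((norm_sum_mul_diag_le_traceNorm _ (fun p => z p.1)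
    fun p => hz p.1).trans h1)
  rw [← Finset.sum_sub_distrib]
  simp only [Fintype.sum_prod_type, Matrix.sub_apply, mul_sub, Fin.sum_univ_one]
  rfl

/-! ### Linear differential equations -/

section
attribute [local instance] Matrix.linftyOpNormedRing Matrix.linftyOpNormedAlgebra

/-- `exp (-s M) v(s)` has zero derivative, so an explicit solution of the differential equation
gives the evolution without diagonalizing `M`. -/
theorem exp_mulVec_eq_of_hasDerivAt {m : Type*} [Fintype m] [DecidableEq m] (M : Matrix m m ℂ)
    (v : ℝ → m → ℂ) (hv : ∀ s, HasDerivAt v (M *ᵥ v s) s) :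
    NormedSpace.exp M *ᵥ v 0 = v 1 := by
  have hE : ∀ s : ℝ, HasDerivAt (fun s : ℝ => NormedSpace.exp (s • -M))
      (NormedSpace.exp (s • -M) * -M) s := fun s => hasDerivAt_exp_smul_const (-M) s
  let L : Matrix m m ℂ →L[ℝ] (m → ℂ) →L[ℝ] (m → ℂ) :=
    LinearMap.toContinuousLinearMap
      ((LinearMap.toContinuousLinearMap.toLinearMap : ((m → ℂ) →ₗ[ℝ] (m → ℂ)) →ₗ[ℝ] _) ∘ₗ
        Matrix.mulVecBilin ℝ ℝ)
  have hd : ∀ s : ℝ, HasDerivAt (fun s : ℝ => NormedSpace.exp (s • -M) *ᵥ v s) 0 s := by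
    intro s
    have := (L.hasFDerivAt.comp_hasDerivAt s (hE s)).clm_apply (hv s)
    refine this.congr_deriv ?_
    change (NormedSpace.exp (s • -M) * -M) *ᵥ v s + NormedSpace.exp (s • -M) *ᵥ (M *ᵥ v s) = 0
    simp [Matrix.mulVec_mulVec, Matrix.neg_mulVec]
  have hc := is_const_of_deriv_eq_zero (fun s => (hd s).differentiableAt)
    (fun s => (hd s).deriv) 0 1
  simp only [zero_smul, NormedSpace.exp_zero, Matrix.one_mulVec, one_smul] at hc
  rw [hc, Matrix.mulVec_mulVec, ← Matrix.exp_add_of_commute _ _ (Commute.refl M).neg_right]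
  simp
end

/-! ### Functions of few bits -/

/-- The span of the functions of `x` that depend on at most `D` of the bits. -/
def juntaSpan (ι : Type*) (D : ℕ) : Submodule ℂ ((ι → Bool) → ℂ) :=
  Submodule.span ℂ {f | ∃ S : Finset ι, S.card ≤ D ∧ DependsOn f (S : Set ι)}

variable {ι : Type*}

theorem const_mem_juntaSpan (D : ℕ) (c : ℂ) : (fun _ => c) ∈ juntaSpan ι D :=
  Submodule.subset_span ⟨∅, by simp, fun _ _ _ => rfl⟩

theorem mul_mem_juntaSpan {D E : ℕ} {f g : (ι → Bool) → ℂ} (hf : f ∈ juntaSpan ι D)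
    (hg : g ∈ juntaSpan ι E) : f * g ∈ juntaSpan ι (D + E) := by
  classical
  have h : f * g ∈ juntaSpan ι D * juntaSpan ι E := Submodule.mul_mem_mul hf hg
  rw [juntaSpan, juntaSpan, Submodule.span_mul_span] at h
  refine Submodule.span_mono ?_ h
  rintro _ ⟨a, ⟨S, hS, ha⟩, b, ⟨T, hT, hb⟩, rfl⟩
  refine ⟨S ∪ T, (Finset.card_union_le _ _).trans (add_le_add hS hT), fun x y hxy => ?_⟩
  have h1 := ha (x := x) (y := y) fun i hi => hxy i (by simp at hi ⊢; exact Or.inl hi)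
  have h2 := hb (x := x) (y := y) fun i hi => hxy i (by simp at hi ⊢; exact Or.inr hi)
  simp [h1, h2]

theorem star_mem_juntaSpan {D : ℕ} {f : (ι → Bool) → ℂ} (hf : f ∈ juntaSpan ι D) :
    star f ∈ juntaSpan ι D := by
  induction hf using Submodule.span_induction with
  | mem f hf =>
    obtain ⟨S, hS, h⟩ := hf
    exact Submodule.subset_span ⟨S, hS, fun x y hxy => by simp [h hxy]⟩
  | zero => simp
  | add f g _ _ hf hg => rw [star_add]; exact add_mem hf hg
  | smul c f _ hf => rw [star_smul]; exact Submodule.smul_mem _ _ hf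

theorem sum_parity_mul_eq_zero [Fintype ι] [DecidableEq ι] {D : ℕ} (hD : D < Fintype.card ι)
    {f : (ι → Bool) → ℂ} (hf : f ∈ juntaSpan ι D) :
    ∑ x : ι → Bool, (∏ i, if x i then (-1 : ℂ) else 1) * f x = 0 := by
  induction hf using Submodule.span_induction with
  | mem f hf =>
    obtain ⟨S, hS, h⟩ := hf
    obtain ⟨i, hi⟩ : ∃ i, i ∉ S := by
      by_contra! hcon
      rw [Finset.eq_univ_iff_forall.2 hcon, Finset.card_univ] at hS
      omega
    -- Flipping a bit outside `S` fixes `f` and negates the parity sign, so the terms cancel in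
    -- pairs.
    refine Finset.sum_involution (fun x _ => Function.update x i (!x i)) ?_ ?_ (by simp) (by simp)
    · intro x _
      have h1 : f (Function.update x i (!x i)) = f x := h fun j hj => by
        rw [Function.update_of_ne]; rintro rfl; exact hi hj
      rw [h1, ← add_mul, Fintype.prod_eq_mul_prod_compl i, Fintype.prod_eq_mul_prod_compl i]
      have h2 : ∏ j ∈ {i}ᶜ, (if Function.update x i (!x i) j then (-1 : ℂ) else 1) =
          ∏ j ∈ {i}ᶜ, if x j then (-1 : ℂ) else 1 :=
        Finset.prod_congr rfl fun j hj => by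
          rw [Function.update_of_ne]; simpa using hj
      rw [h2, ← add_mul]
      cases hx : x i <;> simp
    · intro x _ _ hx
      have := congrFun hx i
      simp at this
  | zero => simp
  | add f g _ _ hf hg => simp [mul_add, Finset.sum_add_distrib, hf, hg]
  | smul c f _ hf =>
    have : ∀ x, (∏ i, if x i then (-1 : ℂ) else 1) * (c • f) x =
        c * ((∏ i, if x i then (-1 : ℂ) else 1) * f x) := fun x => by simp; ring
    simp only [this, ← Finset.mul_sum, hf, mul_zero]

/-! ### Perfect state transfer along a weighted path -/

/-- The weight of the edge between the vertices `k` and `k + 1` of a path of length `N`. -/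
def pathWeight (N k : ℕ) : ℝ := √(((k + 1) * (N - k) : ℕ) : ℝ)

/-- The modulus, up to sign, of the amplitude of vertex `k` after the evolution by the angle `θ`. -/
def pathModulus (N k : ℕ) (θ : ℝ) : ℝ :=
  √(N.choose k : ℝ) * (Real.cos θ ^ (N - k) * Real.sin θ ^ k)

/-- The amplitude of vertex `k` after the evolution by the angle `θ`, starting at vertex `0`. -/
def pathAmp (N k : ℕ) (θ : ℝ) : ℂ := (-Complex.I) ^ k * (pathModulus N k θ : ℂ)

/-- The weighted amplitude of the predecessor of `k` in the path. -/
def predTerm (w : ℕ → ℝ) (ψ : ℕ → ℂ) : ℕ → ℂ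
  | 0 => 0
  | k + 1 => w k * ψ k

theorem pathWeight_eq_zero {N k : ℕ} (h : N ≤ k) : pathWeight N k = 0 := by
  simp [pathWeight, Nat.sub_eq_zero_of_le h]

/-- This identity and the next turn the factors `N - k` and `k + 1`, which arise from
differentiating powers of cosine and sine, into weighted neighbouring amplitudes. -/
theorem pathWeight_mul_sqrt_choose_succ (N k : ℕ) :
    pathWeight N k * √(N.choose (k + 1) : ℝ) = (N - k : ℕ) * √(N.choose k : ℝ) := by
  rw [pathWeight, ← Real.sqrt_mul (Nat.cast_nonneg _), ← Nat.cast_mul,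
    show (k + 1) * (N - k) * N.choose (k + 1) = (N - k) ^ 2 * N.choose k by
      have := Nat.choose_succ_right_eq N k
      calc _ = (N.choose (k + 1) * (k + 1)) * (N - k) := by ring
        _ = _ := by rw [this]; ring]
  rw [Nat.cast_mul, Real.sqrt_mul (Nat.cast_nonneg _), Nat.cast_pow,
    Real.sqrt_sq (Nat.cast_nonneg _)]

theorem pathWeight_mul_sqrt_choose (N k : ℕ) :
    pathWeight N k * √(N.choose k : ℝ) = (k + 1 : ℕ) * √(N.choose (k + 1) : ℝ) := by
  rw [pathWeight, ← Real.sqrt_mul (Nat.cast_nonneg _), ← Nat.cast_mul,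
    show (k + 1) * (N - k) * N.choose k = (k + 1) ^ 2 * N.choose (k + 1) by
      have := Nat.choose_succ_right_eq N k
      calc _ = (N.choose k * (N - k)) * (k + 1) := by ring
        _ = _ := by rw [← this]; ring]
  rw [Nat.cast_mul, Real.sqrt_mul (Nat.cast_nonneg _), Nat.cast_pow,
    Real.sqrt_sq (Nat.cast_nonneg _)]

theorem hasDerivAt_pathModulus_zero (N : ℕ) (θ : ℝ) :
    HasDerivAt (pathModulus N 0) (-(pathWeight N 0 * pathModulus N 1 θ)) θ := by
  have h := ((Real.hasDerivAt_cos θ).pow N).const_mul (√(N.choose 0 : ℝ))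
  have hw := pathWeight_mul_sqrt_choose_succ N 0
  rw [zero_add] at hw
  have hf : pathModulus N 0 = fun θ => √(N.choose 0 : ℝ) * (Real.cos ^ N) θ := by
    funext θ; simp [pathModulus]
  rw [hf]
  refine h.congr_deriv ?_
  simp only [pathModulus, ← mul_assoc]
  rw [hw]
  simp

theorem hasDerivAt_pathModulus_succ (N k : ℕ) (θ : ℝ) :
    HasDerivAt (pathModulus N (k + 1))
      (pathWeight N k * pathModulus N k θ - pathWeight N (k + 1) * pathModulus N (k + 2) θ) θ := by
  have h := (((Real.hasDerivAt_cos θ).pow (N - (k + 1))).mul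
    ((Real.hasDerivAt_sin θ).pow (k + 1))).const_mul (√(N.choose (k + 1) : ℝ))
  have hw := pathWeight_mul_sqrt_choose_succ N (k + 1)
  have hw' := pathWeight_mul_sqrt_choose N k
  refine h.congr_deriv ?_
  simp only [pathModulus, ← mul_assoc]
  rw [hw, hw']
  -- The exponents are truncated differences; past the end of the path all terms carry a vanishing
  -- binomial coefficient.
  rcases le_or_gt (k + 1) N with hk | hk
  · rw [show N - k = N - (k + 1) + 1 by omega, show N - (k + 2) = N - (k + 1) - 1 by omega]
    simp
    ring
  · simp [Nat.choose_eq_zero_of_lt hk]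

/-- Schrödinger equation on the path: the phases `(-i)^k` turn the antisymmetric real recursion into
`-i` times a symmetric hopping. -/
theorem hasDerivAt_pathAmp (N k : ℕ) (θ : ℝ) :
    HasDerivAt (pathAmp N k) (-Complex.I * (pathWeight N k * pathAmp N (k + 1) θ +
      predTerm (pathWeight N) (fun j => pathAmp N j θ) k)) θ := by
  have hI := Complex.I_mul_I
  cases k with
  | zero =>
    refine ((hasDerivAt_pathModulus_zero N θ).ofReal_comp.const_mul _).congr_deriv ?_
    simp only [pathAmp, predTerm]
    push_cast
    linear_combination (-(pathWeight N 0 : ℂ) * pathModulus N 1 θ) * hI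
  | succ k =>
    refine ((hasDerivAt_pathModulus_succ N k θ).ofReal_comp.const_mul _).congr_deriv ?_
    simp only [pathAmp, predTerm]
    push_cast
    linear_combination (-(-Complex.I) ^ (k + 1) * (pathWeight N (k + 1) : ℂ) *
      pathModulus N (k + 2) θ) * hI

theorem pathAmp_zero (N k : ℕ) : pathAmp N k 0 = if k = 0 then 1 else 0 := by
  rcases k with - | k <;> simp [pathAmp, pathModulus]

/-- Perfect state transfer: `cos (π / 2) = 0` kills `k < N`, and the binomial coefficient kills `k >
N`. -/
theorem pathAmp_pi_div_two (N k : ℕ) :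
    pathAmp N k (Real.pi / 2) = if k = N then (-Complex.I) ^ N else 0 := by
  split_ifs with h
  · subst h; simp [pathAmp, pathModulus]
  · rcases lt_or_gt_of_ne h with h | h
    · simp [pathAmp, pathModulus, Nat.sub_ne_zero_of_lt h]
    · simp [pathAmp, pathModulus, Nat.choose_eq_zero_of_lt h]

/-! ### The parity Hamiltonian -/

/-- The `k`-th bit of `x`. -/
def bit {N : ℕ} (x : Fin N → Bool) (k : ℕ) : Bool := if h : k < N then x ⟨k, h⟩ else false

/-- The parity of the first `k` bits of `x`. -/
def par {N : ℕ} (x : Fin N → Bool) : ℕ → Bool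
  | 0 => false
  | k + 1 => xor (par x k) (bit x k)

theorem sign_par {N : ℕ} (x : Fin N → Bool) :
    (if par x N then (-1 : ℂ) else 1) = ∏ i, if x i then (-1 : ℂ) else 1 := by
  have h : ∀ k, (if par x k then (-1 : ℂ) else 1) =
      ∏ j ∈ Finset.range k, if bit x j then (-1 : ℂ) else 1 := by
    intro k
    induction k with
    | zero => simp [par]
    | succ k ih =>
      rw [Finset.prod_range_succ, ← ih, par]
      cases par x k <;> cases bit x k <;> simp
  rw [h, Finset.prod_range]
  simp [bit]

/-- The amplitude of the hop from `p` to its successors: `(k, b, i)` is joined to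
`(k + 1, b ⊕ x k, j)` for all `i, j < d`, with weight `w k`. -/
def hop {N P Q : ℕ} (d : ℕ) (w : ℕ → ℝ) (x : Fin N → Bool) (p q : Fin P × Bool × Fin Q) : ℝ :=
  if (p.2.2 : ℕ) < d ∧ (q.2.2 : ℕ) < d ∧ (p.1 : ℕ) + 1 = q.1 ∧ q.2.1 = xor p.2.1 (bit x p.1)
  then w p.1 else 0

/-- The Hamiltonian of the hops in both directions. -/
def parityHam {N P Q : ℕ} (d : ℕ) (w : ℕ → ℝ) (x : Fin N → Bool) :
    Matrix (Fin P × Bool × Fin Q) (Fin P × Bool × Fin Q) ℂ :=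
  Matrix.of fun p q => ((hop d w x p q + hop d w x q p : ℝ) : ℂ)

theorem parityHam_isHermitian {N P Q : ℕ} (d : ℕ) (w : ℕ → ℝ) (x : Fin N → Bool) :
    (parityHam d w x : Matrix (Fin P × Bool × Fin Q) _ ℂ).IsHermitian := by
  ext p q
  simp [parityHam, add_comm]

/-- Edges at layer `k` are governed only by the bits `k` and `k - 1`. -/
theorem parityHam_row_dependsOn {N P Q : ℕ} (d : ℕ) (w : ℕ → ℝ) (p : Fin P × Bool × Fin Q) :
    ∃ S : Finset (Fin N), S.card ≤ 2 ∧
      DependsOn (fun x : Fin N → Bool => parityHam d w x p) (S : Set (Fin N)) := by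
  classical
  set T : Finset ℕ := {(p.1 : ℕ), (p.1 : ℕ) - 1}
  have hb : ∀ x y : Fin N → Bool, (∀ i : Fin N, (i : ℕ) ∈ T → x i = y i) →
      ∀ k ∈ T, bit x k = bit y k := fun x y hxy k hk => by
    unfold bit; split_ifs with h
    · exact hxy _ hk
    · rfl
  refine ⟨Finset.univ.filter fun i => (i : ℕ) ∈ T, ?_, fun x y hxy => ?_⟩
  · refine (Finset.card_le_card_of_injOn (fun i : Fin N => (i : ℕ)) (t := T) (fun i hi => by
      simpa using hi) Fin.val_injective.injOn).trans Finset.card_le_two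
  · funext q
    have h := hb x y fun i hi => hxy i (by simpa using hi)
    have h1 := h p.1 (by simp [T])
    have h2 : (q.1 : ℕ) + 1 = p.1 → bit x q.1 = bit y q.1 := fun hq =>
      h q.1 (by simp [T, ← hq])
    have h3 : hop d w x p q = hop d w y p q := by simp only [hop, h1]
    have h4 : hop d w x q p = hop d w y q p := by
      unfold hop
      by_cases hq : (q.1 : ℕ) + 1 = p.1
      · rw [h2 hq]
      · simp [hq]
    simp only [parityHam, Matrix.of_apply, h3, h4]

theorem parityHam_rowSupport_card_le {N P Q : ℕ} (d : ℕ) (w : ℕ → ℝ) (x : Fin N → Bool) :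
    IsSparse (2 * d) (parityHam d w x : Matrix (Fin P × Bool × Fin Q) _ ℂ) := by
  intro p
  have hmem : ∀ q ∈ rowSupport (parityHam d w x) p, (q.2.2 : ℕ) < d ∧
      ((p.1 : ℕ) + 1 = q.1 ∧ q.2.1 = xor p.2.1 (bit x p.1) ∨
        (q.1 : ℕ) + 1 = p.1 ∧ p.2.1 = xor q.2.1 (bit x q.1)) := by
    intro q hq
    by_contra hcon
    rw [rowSupport, Finset.mem_filter] at hq
    refine hq.2 ?_
    simp only [parityHam, Matrix.of_apply, hop]
    rw [if_neg (by tauto), if_neg (by tauto)]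
    simp
  have : (Finset.univ ×ˢ Finset.range d : Finset (Bool × ℕ)).card = 2 * d := by simp
  rw [← this]
  -- A neighbour is determined by its direction along the path and its copy index, since its parity
  -- bit is forced by `x`.
  refine Finset.card_le_card_of_injOn
    (fun q : Fin P × Bool × Fin Q => (decide ((p.1 : ℕ) + 1 = q.1), (q.2.2 : ℕ))) ?_ ?_
  · intro q hq
    simpa [em] using (hmem q hq).1
  · rintro ⟨k, b, i⟩ hq ⟨k', b', i'⟩ hq' h
    have h1 := (hmem _ hq).2
    have h2 := (hmem _ hq').2
    simp only [Prod.mk.injEq, decide_eq_decide] at h h1 h2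
    have hk : k = k' := Fin.ext (by omega)
    have hi : i = i' := Fin.ext h.2
    subst hk hi
    have hb : b = b' := by
      rcases h1 with h1 | h1 <;> rcases h2 with h2 | h2
      · rw [h1.2, h2.2]
      · omega
      · omega
      · have := h1.2.symm.trans h2.2
        simpa using this
    rw [hb]

theorem norm_parityHam_apply_le {N P Q : ℕ} {d : ℕ} {w : ℕ → ℝ} {C : ℝ} (hC : 0 ≤ C)
    (hw : ∀ k, |w k| ≤ C) (x : Fin N → Bool) (p q : Fin P × Bool × Fin Q) :
    ‖parityHam d w x p q‖ ≤ C := by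
  simp only [parityHam, Matrix.of_apply, Complex.norm_real, Real.norm_eq_abs, hop]
  split_ifs with h1 h2
  · omega
  · simpa using hw _
  · simpa using hw _
  · simpa using hC

theorem exists_norm_parityHam_apply {N P Q : ℕ} {d : ℕ} (hd : 0 < d) (hQ : 0 < Q) (w : ℕ → ℝ)
    (x : Fin N → Bool) (k : ℕ) (hk : k + 1 < P) :
    ∃ p q : Fin P × Bool × Fin Q, ‖parityHam d w x p q‖ = |w k| := by
  refine ⟨(⟨k, by omega⟩, false, ⟨0, hQ⟩), (⟨k + 1, hk⟩, bit x k, ⟨0, hQ⟩), ?_⟩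
  simp only [parityHam, Matrix.of_apply, Complex.norm_real, Real.norm_eq_abs, hop]
  rw [if_pos (by simp [hd]), if_neg (by simp; omega), add_zero]

theorem sum_block {P Q d : ℕ} (hdQ : d ≤ Q) {k : ℕ} (hk : k < P) (b : Bool) (c : ℂ) :
    ∑ q : Fin P × Bool × Fin Q,
      (if (q.1 : ℕ) = k ∧ q.2.1 = b ∧ (q.2.2 : ℕ) < d then c else 0) = d * c := by
  have h : (Finset.univ.filter fun q : Fin P × Bool × Fin Q =>
      (q.1 : ℕ) = k ∧ q.2.1 = b ∧ (q.2.2 : ℕ) < d) =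
      {⟨k, hk⟩} ×ˢ {b} ×ˢ Finset.univ.filter fun i : Fin Q => (i : ℕ) < d := by
    ext ⟨k', b', i⟩
    simp only [Finset.mem_filter, Finset.mem_univ, true_and, Finset.mem_product,
      Finset.mem_singleton, Fin.ext_iff]
  rw [← Finset.sum_filter, Finset.sum_const, h, Finset.card_product, Finset.card_product]
  simp [Fin.card_filter_val_lt, hdQ]

/-- The state with amplitudes `ψ k` at the vertices `(k, b, i)`, `b` the parity of the first `k`
bits and `i < d`. -/
def parityState {N : ℕ} (P Q d : ℕ) (x : Fin N → Bool) (ψ : ℕ → ℂ) (p : Fin P × Bool × Fin Q) : ℂ :=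
  if p.2.1 = par x p.1 ∧ (p.2.2 : ℕ) < d then ψ p.1 else 0

/-- Each vertex receives equal contributions from the `d` copies in an adjacent layer. Hops respect
the running parity, so the support is preserved; weights vanishing from `N` on prevent leakage past
layer `N`. -/
theorem parityHam_mulVec {N P Q d : ℕ} (hP : N < P) (hdQ : d ≤ Q) {w : ℕ → ℝ}
    (hw : ∀ k, N ≤ k → w k = 0) (x : Fin N → Bool) (ψ : ℕ → ℂ) :
    parityHam d w x *ᵥ parityState P Q d x ψ =
      parityState P Q d x fun k => d * (w k * ψ (k + 1) + predTerm w ψ k) := by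
  have h1 : ∀ p : Fin P × Bool × Fin Q, ∑ q, (hop d w x p q : ℂ) * parityState P Q d x ψ q =
      if p.2.1 = par x p.1 ∧ (p.2.2 : ℕ) < d then d * (w p.1 * ψ (p.1 + 1)) else 0 := by
    rintro ⟨k, b, i⟩
    split_ifs with h
    · simp only at h
      obtain ⟨rfl, hi⟩ := h
      rcases lt_or_ge ((k : ℕ) + 1) P with hk | hk
      · rw [← sum_block hdQ hk (par x (k + 1))]
        refine Finset.sum_congr rfl ?_
        rintro ⟨k', b', i'⟩ -
        simp only [hop, parityState, hi, par]
        by_cases hk' : (k' : ℕ) = k + 1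
        · by_cases hi' : (i' : ℕ) < d <;> simp [hk', hi', par]
          split_ifs <;> simp
        · simp [hk', Ne.symm hk']
      · have hN : N ≤ (k : ℕ) := by omega
        simp [hop, hw _ hN]
    · refine Finset.sum_eq_zero ?_
      rintro ⟨k', b', i'⟩ -
      simp only [hop, parityState]
      simp only at h
      by_cases hc : (i : ℕ) < d ∧ (i' : ℕ) < d ∧ (k : ℕ) + 1 = k' ∧ b' = xor b (bit x k)
      · suffices h' : ¬(b' = par x k' ∧ (i' : ℕ) < d) by rw [if_neg h', mul_zero]
        rintro ⟨h2, -⟩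
        rw [← hc.2.2.1, hc.2.2.2, par] at h2
        exact h ⟨by simpa using h2, hc.1⟩
      · rw [if_neg hc]; simp
  have h2 : ∀ p : Fin P × Bool × Fin Q, ∑ q, (hop d w x q p : ℂ) * parityState P Q d x ψ q =
      if p.2.1 = par x p.1 ∧ (p.2.2 : ℕ) < d then d * predTerm w ψ p.1 else 0 := by
    rintro ⟨⟨k, hk⟩, b, i⟩
    cases k with
    | zero => simp [hop, predTerm]
    | succ k =>
      simp only [predTerm]
      split_ifs with h
      · obtain ⟨rfl, hi⟩ := h
        rw [← sum_block hdQ (Nat.lt_of_succ_lt hk) (par x k)]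
        refine Finset.sum_congr rfl ?_
        rintro ⟨k', b', i'⟩ -
        simp only [hop, parityState, hi, par]
        by_cases hk' : (k' : ℕ) = k
        · by_cases hi' : (i' : ℕ) < d <;> simp [hk', hi']
          by_cases hb : b' = par x k <;> simp [hb]
        · simp [hk']
      · refine Finset.sum_eq_zero ?_
        rintro ⟨k', b', i'⟩ -
        simp only [hop, parityState]
        by_cases hc : b' = par x k' ∧ (i' : ℕ) < d
        · rw [if_neg, Complex.ofReal_zero, zero_mul]
          rintro ⟨-, h3, h4, h5⟩
          obtain rfl : (k' : ℕ) = k := by omega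
          exact h ⟨by rw [h5, hc.1, par], h3⟩
        · rw [if_neg hc, mul_zero]
  funext p
  have : (parityHam d w x *ᵥ parityState P Q d x ψ) p =
      ∑ q, (hop d w x p q : ℂ) * parityState P Q d x ψ q +
        ∑ q, (hop d w x q p : ℂ) * parityState P Q d x ψ q := by
    simp only [Matrix.mulVec, dotProduct, parityHam, Matrix.of_apply, Complex.ofReal_add, add_mul,
      Finset.sum_add_distrib]
  rw [this, h1, h2, parityState]
  split_ifs <;> simp [mul_add]

theorem predTerm_const_mul (g : ℝ) (κ : ℂ) (w : ℕ → ℝ) (ψ : ℕ → ℂ) (k : ℕ) :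
    predTerm (fun k => g * w k) (fun k => κ * ψ k) k = g * κ * predTerm w ψ k := by
  cases k
  · simp [predTerm]
  · simp only [predTerm]; push_cast; ring

theorem evolution_parityHam_mulVec {N P Q d D : ℕ} (e : Fin D ≃ Fin P × Bool × Fin Q)
    (hP : N < P) (hdQ : d ≤ Q) (x : Fin N → Bool) (g t : ℝ) (hg : t * d * g = Real.pi / 2) (κ : ℂ) :
    evolution ((parityHam d (fun k => g * pathWeight N k) x).submatrix e e) t *ᵥ
        (fun s => if ((e s).1 : ℕ) = 0 ∧ (e s).2.1 = false ∧ ((e s).2.2 : ℕ) < d then κ else 0) =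
      fun s => if ((e s).1 : ℕ) = N ∧ (e s).2.1 = par x N ∧ ((e s).2.2 : ℕ) < d
        then κ * (-Complex.I) ^ N else 0 := by
  -- The angle `s * (π / 2)` rescales time so that `s = 1` is the end of the evolution.
  set v : ℝ → Fin D → ℂ := fun s =>
    parityState P Q d x (fun k => κ * pathAmp N k (s * (Real.pi / 2))) ∘ e
  have hv0 : v 0 = fun s =>
      if ((e s).1 : ℕ) = 0 ∧ (e s).2.1 = false ∧ ((e s).2.2 : ℕ) < d then κ else 0 := by
    funext s
    simp only [v, Function.comp, parityState, zero_mul, pathAmp_zero]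
    by_cases h : ((e s).1 : ℕ) = 0
    · simp [h, par]
    · simp [h]
  have hv1 : v 1 = fun s => if ((e s).1 : ℕ) = N ∧ (e s).2.1 = par x N ∧ ((e s).2.2 : ℕ) < d
        then κ * (-Complex.I) ^ N else 0 := by
    funext s
    simp only [v, Function.comp, parityState, one_mul, pathAmp_pi_div_two]
    by_cases h : ((e s).1 : ℕ) = N
    · simp [h]
    · simp [h]
  rw [← hv0, ← hv1, evolution]
  refine exp_mulVec_eq_of_hasDerivAt _ v fun s => ?_
  rw [Matrix.smul_mulVec, Matrix.submatrix_mulVec_equiv]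
  have hcomp : v s ∘ e.symm = parityState P Q d x
      (fun k => κ * pathAmp N k (s * (Real.pi / 2))) := by
    funext p; simp [v]
  rw [hcomp, parityHam_mulVec hP hdQ (fun k hk => by rw [pathWeight_eq_zero hk, mul_zero])]
  rw [hasDerivAt_pi]
  intro i
  simp only [v, Function.comp, parityState, Pi.smul_apply, smul_eq_mul]
  split_ifs
  · have h := ((hasDerivAt_pathAmp N (e i).1 (s * (Real.pi / 2))).scomp s
      ((hasDerivAt_id s).mul_const (Real.pi / 2))).const_mul κ
    refine h.congr_deriv ?_
    rw [predTerm_const_mul, one_mul, ← hg]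
    simp only [Complex.real_smul]
    push_cast
    ring
  · simpa using hasDerivAt_const s (0 : ℂ)

/-! ### The polynomial method -/

theorem callMap_eq_of_row_eq {n b : ℕ} (enc : ℂ → Bits b)
    {H H' : Matrix (Fin (2 ^ n)) (Fin (2 ^ n)) ℂ} (c : Call) (q : QueryReg n b)
    (h : H q.1 = H' q.1) : callMap enc H c q = callMap enc H' c q := by
  obtain ⟨j, k, z⟩ := q
  have hs : rowSupport H j = rowSupport H' j := by
    unfold rowSupport
    simp only at h
    rw [h]
  have hl : locPerm H j = locPerm H' j := by
    unfold locPerm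
    -- The proofs inside `locPerm` mention the row support, so they are abstracted before rewriting
    -- it.
    generalize_proofs h1 h2 h3
    revert h1 h2 h3
    rw [hs]
    intros
    rfl
  have h : H j = H' j := h
  cases c <;> simp [callMap, hl, h]

/-- The unitaries only form linear combinations with coefficients independent of `x`; each query
multiplies by an entry read from a single row, which costs `m` more bits. -/
theorem opAux_mulVec_mem_juntaSpan {ι : Type*} {n b m : ℕ} (A : QueryAlgorithm n b)
    (enc : ℂ → Bits b) (H : (ι → Bool) → Matrix (Fin (2 ^ n)) (Fin (2 ^ n)) ℂ)
    (hH : ∀ j, ∃ S : Finset ι, S.card ≤ m ∧ DependsOn (fun x => H x j) (S : Set ι))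
    (φ : Register n b A.work → ℂ) (i : ℕ) (hi : i ≤ A.queries) (r : Register n b A.work) :
    (fun x => (A.opAux enc (H x) i hi *ᵥ φ) r) ∈ juntaSpan ι (i * m) := by
  induction i generalizing r with
  | zero => exact const_mem_juntaSpan (0 * m) (((A.unitary 0).1 *ᵥ φ) r)
  | succ i ih =>
    have h : (fun x => (A.opAux enc (H x) (i + 1) hi *ᵥ φ) r) =
        ∑ y, ∑ s, (A.unitary ⟨i + 1, Nat.lt_succ_of_le hi⟩).1 r y •
          ((fun x => (A.opAux enc (H x) i (Nat.le_of_succ_le hi) *ᵥ φ) s) *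
            fun x => queryOp enc (H x) (A.sel ⟨i, hi⟩) y s) := by
      funext x
      rw [QueryAlgorithm.opAux, ← Matrix.mulVec_mulVec, ← Matrix.mulVec_mulVec]
      simp only [Finset.sum_apply, Pi.smul_apply, Pi.mul_apply]
      generalize A.opAux enc (H x) i (Nat.le_of_succ_le hi) *ᵥ φ = u
      simp [Matrix.mulVec, dotProduct, Finset.mul_sum, mul_comm]
    rw [h]
    refine Submodule.sum_mem _ fun y _ => Submodule.sum_mem _ fun s _ =>
      Submodule.smul_mem _ _ ?_
    rw [Nat.succ_mul]
    refine mul_mem_juntaSpan (ih _ _) (Submodule.subset_span ?_)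
    obtain ⟨S, hS, hd⟩ := hH s.1
    refine ⟨S, hS, fun x x' hx => ?_⟩
    simp only [queryOp, Matrix.of_apply]
    rw [callMap_eq_of_row_eq enc _ (s.1, s.2.1, s.2.2.1) (hd hx)]

/-- The state `v` of the system together with the ancilla in its initial state. -/
def initialState {n b w : ℕ} (v : Fin (2 ^ n) → ℂ) : Register n b w → ℂ :=
  fun r => if r.2 = QueryAlgorithm.ancillaZero n b w then v r.1 else 0

theorem channel_vecMulVec_diag {n b : ℕ} (A : QueryAlgorithm n b) (enc : ℂ → Bits b)
    (H : Matrix (Fin (2 ^ n)) (Fin (2 ^ n)) ℂ) (v : Fin (2 ^ n) → ℂ) (i : Fin (2 ^ n)) :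
    A.channel enc H (Matrix.vecMulVec v (star v)) i i =
      ∑ a, (A.op enc H *ᵥ initialState v) (i, a) *
        star ((A.op enc H *ᵥ initialState v) (i, a)) := by
  set φ : Register n b A.work → ℂ := initialState v
  have h : Matrix.vecMulVec v (star v) ⊗ₖ
      Matrix.single (QueryAlgorithm.ancillaZero n b A.work)
        (QueryAlgorithm.ancillaZero n b A.work) (1 : ℂ) =
        Matrix.vecMulVec φ (star φ) := by
    ext r s
    by_cases h1 : r.2 = QueryAlgorithm.ancillaZero n b A.work <;>
    by_cases h2 : s.2 = QueryAlgorithm.ancillaZero n b A.work <;>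
    simp [Matrix.kroneckerMap_apply, Matrix.vecMulVec_apply, φ, initialState,
      h1, h2, eq_comm]
  rw [QueryAlgorithm.channel, h, conjChannel, Matrix.mul_vecMulVec, Matrix.vecMulVec_mul,
    ← Matrix.star_mulVec]
  simp [partialTrace, Matrix.vecMulVec_apply]

theorem conjChannel_vecMulVec_diag {m : Type*} [Fintype m] (U : Matrix m m ℂ) (v : m → ℂ) (i : m) :
    conjChannel U (Matrix.vecMulVec v (star v)) i i = (U *ᵥ v) i * star ((U *ᵥ v) i) := by
  rw [conjChannel, Matrix.mul_vecMulVec, Matrix.vecMulVec_mul, ← Matrix.star_mulVec]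
  simp [Matrix.vecMulVec_apply]

/-- If a diagonal observable `z` of the evolved state `v` gives the parity of `x`, and every row of
`H x` depends on at most `m` bits of `x`, then simulating all the `H x` takes `N / (2 * m)`
queries. -/
theorem card_le_of_simulates_of_parity {ι : Type*} [Fintype ι] [DecidableEq ι] {n b m : ℕ}
    (A : QueryAlgorithm n b) (enc : ℂ → Bits b)
    (H : (ι → Bool) → Matrix (Fin (2 ^ n)) (Fin (2 ^ n)) ℂ)
    (hH : ∀ j, ∃ S : Finset ι, S.card ≤ m ∧ DependsOn (fun x => H x j) (S : Set ι))
    {v z : Fin (2 ^ n) → ℂ} (hv : v ⬝ᵥ star v = 1) (hz : ∀ i, ‖z i‖ ≤ 1) {t ε : ℝ} (hε : 0 < ε)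
    (hε1 : ε < 1)
    (hpar : ∀ x, ∑ i, z i * ((evolution (H x) t *ᵥ v) i * star ((evolution (H x) t *ᵥ v) i)) =
      ∏ i, if x i then (-1 : ℂ) else 1)
    (hA : ∀ x, A.Simulates enc (H x) t ε) :
    Fintype.card ι ≤ 2 * (A.queries * m) := by
  by_contra! hlt
  set P : (ι → Bool) → ℂ := fun x =>
    ∑ i, z i * A.channel enc (H x) (Matrix.vecMulVec v (star v)) i i
  have hP : P ∈ juntaSpan ι (2 * (A.queries * m)) := by
    set φ : Register n b A.work → ℂ := initialState v
    have h : P = ∑ i, ∑ a, z i • ((fun x => (A.op enc (H x) *ᵥ φ) (i, a)) *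
        star fun x => (A.op enc (H x) *ᵥ φ) (i, a)) := by
      funext x
      simp only [P, channel_vecMulVec_diag, Finset.sum_apply, Finset.mul_sum]
      rfl
    rw [h]
    refine Submodule.sum_mem _ fun i _ => Submodule.sum_mem _ fun a _ =>
      Submodule.smul_mem _ _ ?_
    have h1 := opAux_mulVec_mem_juntaSpan A enc H hH φ A.queries le_rfl (i, a)
    -- A probability is an amplitude times its conjugate, which doubles the number of bits.
    rw [two_mul]
    exact mul_mem_juntaSpan h1 (star_mem_juntaSpan h1)
  have hsum := sum_parity_mul_eq_zero hlt hP
  have hsgn : ∀ x : ι → Bool, ‖∏ i, if x i then (-1 : ℂ) else 1‖ = 1 := fun x => by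
    rw [norm_prod]
    exact Finset.prod_eq_one fun i _ => by split <;> simp
  have hsq : ∀ x : ι → Bool, (∏ i, if x i then (-1 : ℂ) else 1) *
      (∏ i, if x i then (-1 : ℂ) else 1) = 1 := fun x => by
    rw [← Finset.prod_mul_distrib]
    exact Finset.prod_eq_one fun i _ => by split <;> simp
  have hclose : ∀ x, ‖(∏ i, if x i then (-1 : ℂ) else 1) * P x - 1‖ ≤ ε := fun x => by
    have h := norm_sum_mul_diag_le_of_diamondDist_le hε.le (hA x) hv z hz
    simp only [conjChannel_vecMulVec_diag, hpar] at h
    have h2 := hsq x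
    have h3 := hsgn x
    generalize (∏ i, if x i then (-1 : ℂ) else 1) = a at h h2 h3 ⊢
    rw [← h2, ← mul_sub, norm_mul, h3, one_mul]
    exact h
  -- Summed over `x`, the products with the sign vanish, leaving the number of inputs bounded by `ε`
  -- times itself.
  have h1 : ‖∑ x, ((∏ i, if x i then (-1 : ℂ) else 1) * P x - 1)‖ ≤ ∑ _x : ι → Bool, ε :=
    norm_sum_le_of_le _ fun x _ => hclose x
  rw [Finset.sum_sub_distrib, hsum] at h1
  simp only [Finset.sum_const, zero_sub, norm_neg, nsmul_eq_mul, mul_one, Complex.norm_natCast]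
    at h1
  have h2 : (0 : ℝ) < (Finset.univ : Finset (ι → Bool)).card := by
    exact_mod_cast Finset.card_pos.2 Finset.univ_nonempty
  nlinarith

/-! ### The lower bound -/

theorem maxNorm_le {m : Type*} [Fintype m] {H : Matrix m m ℂ} {C : ℝ} (hC : 0 ≤ C)
    (h : ∀ j k, ‖H j k‖ ≤ C) : maxNorm H ≤ C := by
  rw [maxNorm, ← NNReal.coe_mk C hC, NNReal.coe_le_coe]
  exact Finset.sup_le fun p _ => h p.1 p.2

theorem norm_apply_le_maxNorm {m : Type*} [Fintype m] (H : Matrix m m ℂ) (j k : m) :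
    ‖H j k‖ ≤ maxNorm H :=
  NNReal.coe_le_coe.2
    (Finset.le_sup (f := fun p : m × m => ‖H p.1 p.2‖₊) (Finset.mem_univ (j, k)))

theorem IsSparse.submatrix {m l : Type*} [Fintype m] [Fintype l] {s : ℕ} {H : Matrix m m ℂ}
    (h : IsSparse s H) (e : l ≃ m) : IsSparse s (H.submatrix e e) := by
  intro j
  refine le_trans (Finset.card_le_card_of_injOn e (fun k hk => ?_) e.injective.injOn) (h (e j))
  rw [SetLike.mem_coe, rowSupport, Finset.mem_filter] at hk ⊢
  exact ⟨Finset.mem_univ _, hk.2⟩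

theorem pathWeight_nonneg (N k : ℕ) : 0 ≤ pathWeight N k := Real.sqrt_nonneg _

theorem pathWeight_le (N k : ℕ) : pathWeight N k ≤ N := by
  rcases le_or_gt N k with h | h
  · simp [pathWeight_eq_zero h]
  · refine Real.sqrt_le_iff.2 ⟨Nat.cast_nonneg _, ?_⟩
    rw [sq, ← Nat.cast_mul, Nat.cast_le]
    exact Nat.mul_le_mul h (Nat.sub_le _ _)

/-- At the middle edge both factors under the root are at least `N / 2`. -/
theorem half_le_pathWeight (N : ℕ) : (N : ℝ) / 2 ≤ pathWeight N (N / 2) := by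
  refine Real.le_sqrt_of_sq_le ?_
  have h1 : (N : ℝ) / 2 ≤ (N / 2 + 1 : ℕ) := by
    rw [div_le_iff₀ two_pos]; exact_mod_cast (by omega : N ≤ (N / 2 + 1) * 2)
  have h2 : (N : ℝ) / 2 ≤ (N - N / 2 : ℕ) := by
    rw [div_le_iff₀ two_pos]; exact_mod_cast (by omega : N ≤ (N - N / 2) * 2)
  rw [Nat.cast_mul, sq]
  exact mul_le_mul h1 h2 (by positivity) (by positivity)

theorem sum_embedded_block {P Q d D : ℕ} (e : Fin D ≃ Fin P × Bool × Fin Q) (hdQ : d ≤ Q) {k : ℕ}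
    (hk : k < P) (b : Bool) (c : ℂ) :
    ∑ s, (if ((e s).1 : ℕ) = k ∧ (e s).2.1 = b ∧ ((e s).2.2 : ℕ) < d then c else 0) = d * c := by
  rw [← sum_block hdQ hk b c]
  exact e.sum_comp fun q => if (q.1 : ℕ) = k ∧ q.2.1 = b ∧ (q.2.2 : ℕ) < d then c else 0

/-- Simulating the parity Hamiltonians for the time of perfect state transfer takes `N / 4`
queries. -/
theorem le_queries_of_simulates_parityHam {N P Q d n b : ℕ}
    (e : Fin (2 ^ n) ≃ Fin P × Bool × Fin Q) (hP : N < P) (hd : 0 < d) (hdQ : d ≤ Q) {g t : ℝ}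
    (hg : t * d * g = Real.pi / 2) (enc : ℂ → Bits b) {ε : ℝ} (hε : 0 < ε) (hε1 : ε < 1)
    (A : QueryAlgorithm n b)
    (hA : ∀ x : Fin N → Bool,
      A.Simulates enc ((parityHam d (fun k => g * pathWeight N k) x).submatrix e e) t ε) :
    N ≤ 4 * A.queries := by
  set κ : ℂ := (((√(d : ℝ))⁻¹ : ℝ) : ℂ)
  have hκ : (d : ℂ) * (κ * star κ) = 1 := by
    have h : (d : ℝ) * ((√(d : ℝ))⁻¹ * (√(d : ℝ))⁻¹) = 1 := by
      rw [← mul_inv, Real.mul_self_sqrt (Nat.cast_nonneg _), mul_inv_cancel₀]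
      exact_mod_cast hd.ne'
    simp only [κ, RCLike.star_def, Complex.conj_ofReal]
    exact_mod_cast congrArg Complex.ofReal h
  -- The observable reads off the sign of the parity bit in the last layer.
  set z : Fin (2 ^ n) → ℂ := fun s =>
    if ((e s).1 : ℕ) = N then (if (e s).2.1 then -1 else 1) else 0
  have key := card_le_of_simulates_of_parity (m := 2) A enc
    (fun x : Fin N → Bool => (parityHam d (fun k => g * pathWeight N k) x).submatrix e e)
    (v := fun s => if ((e s).1 : ℕ) = 0 ∧ (e s).2.1 = false ∧ ((e s).2.2 : ℕ) < d then κ else 0)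
    (z := z) (fun j => ?_) ?_ ?_ hε hε1 (fun x => ?_) hA
  · rw [Fintype.card_fin] at key
    omega
  · obtain ⟨S, hS, h⟩ := parityHam_row_dependsOn (N := N) d (fun k => g * pathWeight N k) (e j)
    exact ⟨S, hS, fun x y hxy => funext fun k => congrFun (h hxy) (e k)⟩
  · rw [← hκ, ← sum_embedded_block e hdQ (Nat.zero_lt_of_lt hP) false]
    refine Finset.sum_congr rfl fun s _ => ?_
    simp only [Pi.star_apply]
    split_ifs <;> simp
  · intro s
    simp only [z]
    split_ifs <;> simp
  · rw [evolution_parityHam_mulVec e hP hdQ x g t hg κ, ← sign_par]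
    have hI : (-Complex.I) ^ N * star ((-Complex.I) ^ N) = 1 := by
      rw [star_pow, ← mul_pow]; simp
    have h : (if par x N then (-1 : ℂ) else 1) =
        d * ((if par x N then (-1 : ℂ) else 1) * (κ * star κ)) := by
      rw [mul_left_comm, hκ, mul_one]
    rw [h, ← sum_embedded_block e hdQ hP (par x N)]
    refine Finset.sum_congr rfl fun s _ => ?_
    simp only [z]
    by_cases hs : ((e s).1 : ℕ) = N ∧ (e s).2.1 = par x N ∧ ((e s).2.2 : ℕ) < d
    · rw [if_pos hs, if_pos hs, if_pos hs.1, hs.2.1, star_mul, mul_comm (star _) (star κ),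
        mul_mul_mul_comm, hI, mul_one]
    · rw [if_neg hs, if_neg hs]; simp

end HamSim

end

theorem mainTheorem4 :
    ∀ τ₀ : ℝ, 0 < τ₀ →
      ∃ c₁ c₂ c : ℝ, 0 < c₁ ∧ c₁ ≤ c₂ ∧ 0 < c ∧
        ∀ (d : ℕ) (t : ℝ), 0 < d → 0 < t → τ₀ ≤ t * d →
          ∃ (n : ℕ) (𝓗 : Finset (Matrix (Fin (2 ^ n)) (Fin (2 ^ n)) ℂ)),
            𝓗.Nonempty ∧
            (∀ H ∈ 𝓗, H.IsHermitian ∧ HamSim.IsSparse (2 * d) H ∧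
              c₁ ≤ HamSim.maxNorm H ∧ HamSim.maxNorm H ≤ c₂) ∧
            ∀ (b : ℕ) (enc : ℂ → HamSim.Bits b),
              Set.InjOn enc {z : ℂ | ∃ H ∈ 𝓗, ∃ j k, H j k = z} →
              ∀ (ε : ℝ), 0 < ε → ε < 1 →
              ∀ (A : HamSim.QueryAlgorithm n b),
                (∀ H ∈ 𝓗, A.Simulates enc H t ε) → c * (t * d) ≤ (A.queries : ℝ) := by
  classical
  open HamSim in
  intro τ₀ hτ
  have hpi := Real.pi_pos
  -- With `T = t * d`, `T ≤ N ≤ T + 1` and `g * T = π / 2`: the middle weight is at least `g * T / 2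
  -- = π / 4`, all weights are at most `g * (T + 1) ≤ (π / 2) * (1 + 1 / τ₀)`, and `T ≤ N ≤ 4 *
  -- A.queries`.
  refine ⟨Real.pi / 4, Real.pi / 2 * (1 + 1 / τ₀), 1 / 4, by positivity, ?_, by norm_num, ?_⟩
  · have : 0 < 1 / τ₀ := by positivity
    nlinarith
  intro d t hd ht htd
  set T : ℝ := t * d
  have hT : 0 < T := hτ.trans_le htd
  set N := ⌈T⌉₊
  have hTN : T ≤ N := Nat.le_ceil T
  have hNT : (N : ℝ) ≤ T + 1 := (Nat.ceil_lt_add_one hT.le).le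
  have hN : 0 < N := Nat.ceil_pos.2 hT
  set g : ℝ := Real.pi / (2 * T)
  have hgT : T * g = Real.pi / 2 := by simp only [g]; field_simp
  have hg0 : 0 < g := by positivity
  -- Layers and copies are padded to powers of two so that the dimension is `2 ^ n`; the extra
  -- vertices are isolated.
  have hP : N < 2 ^ (N + 1) := (Nat.lt_succ_self N).trans Nat.lt_two_pow_self
  have hcard : Fintype.card (Fin (2 ^ (N + 1)) × Bool × Fin (2 ^ d)) = 2 ^ (N + 1 + (1 + d)) := by
    simp [pow_add]
  let e := (Fintype.equivFinOfCardEq hcard).symm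
  let H : (Fin N → Bool) → Matrix (Fin (2 ^ (N + 1 + (1 + d)))) (Fin (2 ^ (N + 1 + (1 + d)))) ℂ :=
    fun x => (parityHam d (fun k => g * pathWeight N k) x).submatrix e e
  refine ⟨N + 1 + (1 + d), Finset.univ.image H, Finset.univ_nonempty.image H, ?_, ?_⟩
  · intro M hM
    obtain ⟨x, -, rfl⟩ := Finset.mem_image.1 hM
    refine ⟨(parityHam_isHermitian _ _ x).submatrix e,
      (parityHam_rowSupport_card_le _ _ x).submatrix e, ?_, ?_⟩
    · obtain ⟨p, q, hpq⟩ := exists_norm_parityHam_apply (P := 2 ^ (N + 1)) (Q := 2 ^ d) hd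
        (by positivity) (fun k => g * pathWeight N k) x (N / 2) (by omega)
      have h := norm_apply_le_maxNorm (H x) (e.symm p) (e.symm q)
      simp only [H, Matrix.submatrix_apply, Equiv.apply_symm_apply, hpq] at h
      refine le_trans ?_ ((le_abs_self _).trans h)
      have := half_le_pathWeight N
      calc Real.pi / 4 = g * (T / 2) := by linarith
        _ ≤ g * pathWeight N (N / 2) := by gcongr; linarith
    · refine maxNorm_le (by positivity) fun j k =>
        norm_parityHam_apply_le (by positivity) (fun i => ?_) x _ _
      rw [abs_of_nonneg (mul_nonneg hg0.le (pathWeight_nonneg N i))]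
      have h1 : 1 ≤ T * (1 / τ₀) := by rw [mul_one_div, le_div_iff₀ hτ]; linarith
      calc g * pathWeight N i ≤ g * (T + T * (1 / τ₀)) := by
            gcongr; linarith [pathWeight_le N i]
        _ = Real.pi / 2 * (1 + 1 / τ₀) := by rw [← hgT]; ring
  · intro b enc _ ε hε hε1 A hA
    have h := le_queries_of_simulates_parityHam e hP hd Nat.lt_two_pow_self.le hgT enc hε hε1 A
      fun x => hA (H x) (Finset.mem_image_of_mem H (Finset.mem_univ x))
    have h' : (N : ℝ) ≤ 4 * A.queries := by exact_mod_cast h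
    linarith
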